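/- Let $d\ge 3$ be an integer, let $\log$ be the natural logarithm, and let $$S_d=\Big\{x\in\mathbb R^d:\ \|x\|_2=1,\ \sum_{i=1}^d x_i=0\Big\}.$$ For $x\in S_d$ let $P_x=(|x_i|^2)_{i=1}^d$, which is a probability vector. For a probability vector $p=(p_i)_{i=1}^d$ let $$H_\alpha(p)=\frac1{1-\alpha}\log\sum_{i=1}^d p_i^\alpha\quad(\alpha\in(0,1)\cup(1,\infty)),\qquad H(p)=-\sum_{i=1}^d p_i\log p_i,$$ with the convention $0\log 0=0$. Then for every $\alpha\in(0,1)\cup(1,\infty)$ the minimum of $H_\alpha(P_x)$ over $x\in S_d$ exists and $$\min_{x\in S_d}H_\alpha(P_x)=\min\left\{\log 2,\ \frac1{1-\alpha}\log\left(\frac{(d-1)^\alpha+(d-1)^{1-\alpha}}{d^\alpha}\right)\right\}.$$ Moreover, the minimum of $H(P_x)$ over $x\in S_d$ exists, equals $$\min_{x\in S_d}H(P_x)=\begin{cases}\log 2,& d\le 6,\\ \log d-\dfrac{d-2}{d}\log(d-1),& d\ge 7,\end{cases}$$ and is the limit of $\min_{x\in S_d}H_\alpha(P_x)$ as $\alpha\to1$.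 -/

import Mathlib

open Filter Topology

/-- The zero-sum unit vectors of `ℝ^d`: `‖x‖₂ = 1` and `∑ i, x i = 0`. -/
def zeroSumSphere (d : ℕ) : Set (EuclideanSpace ℝ (Fin d)) :=
  {x | ‖x‖ = 1 ∧ ∑ i, x i = 0}

/-- The vector `P_x = (|x_i|²)_i`, a probability vector when `‖x‖₂ = 1`. -/
def sqDensity {d : ℕ} (x : EuclideanSpace ℝ (Fin d)) : Fin d → ℝ :=
  fun i => |x i| ^ 2

/-- The `α`-Rényi entropy (natural logarithm) of a probability vector, meant for
`α ∈ (0,1) ∪ (1,∞)`; there `0 ^ α = 0`, as usual. -/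
noncomputable def renyiEntropy {d : ℕ} (α : ℝ) (p : Fin d → ℝ) : ℝ :=
  1 / (1 - α) * Real.log (∑ i, p i ^ α)

/-- The Shannon entropy (natural logarithm) of a probability vector; `0 log 0 = 0`. -/
noncomputable def shannonEntropy {d : ℕ} (p : Fin d → ℝ) : ℝ :=
  -∑ i, p i * Real.log (p i)

/-! Put p = P_x. The power sum ∑ p_i^α is to be bounded above for α > 1 and below for α < 1; the two
candidates come from (1, -1, 0, …, 0) and (d-1, -1, …, -1). If every p_i ≤ 1/2, comparing p_i^(α-1)
with (1/2)^(α-1) already gives log 2. Otherwise some entry, say t > 0 after a change of sign, has t²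
> 1/2.

The other entries, negated, have sum t and sum of squares 1 - t². A quadratic majorant of f(y) =
±y^(2α) (`exists_quadratic_majorant`) shows that, with these two moments fixed, ∑ f is at most its
value at a two-level vector (a, b, …, b) (`sum_abs_le_two_level`). This needs f' convex with f'(0) =
0, hence α > 1/2; for α ≤ 1/2 an ℓ¹ estimate suffices (`le_sum_rpow_of_exponent_le_half`).

What remains is a function of r = b/a in [0, 1], `powerRatio` with m = d - 2 and q = 2α - 1, whose
ends r = 0, 1 are the two candidates. Its derivative has the sign of `powerSlope`, which changes
sign at most once and in the direction that puts the extremum at an end (`powerSlope_nonneg_of_pos`,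
`powerSlope_nonpos_of_neg`).

The Shannon case is the limit α → 1, followed by a numerical comparison of the two candidate values.
-/

/-! ### Sign changes and maxima at the ends of an interval -/

/-- A function vanishing at both ends of `[0, 1]` whose second derivative changes sign at most once,
from nonnegative to nonpositive, changes sign at most once, from nonpositive to nonnegative. -/
theorem nonneg_of_pos_of_deriv2_sign {D D' D'' : ℝ → ℝ} (hc : ContinuousOn D (Set.Icc 0 1))
    (h0 : D 0 = 0) (h1 : D 1 = 0)
    (hD : ∀ r ∈ Set.Ioo (0 : ℝ) 1, HasDerivAt D (D' r) r)
    (hD' : ∀ r ∈ Set.Ioo (0 : ℝ) 1, HasDerivAt D' (D'' r) r)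
    (hs : ∀ r s : ℝ, 0 < r → r < s → s < 1 → D'' r < 0 → D'' s ≤ 0)
    {r s : ℝ} (hr : 0 < r) (hrs : r < s) (hs1 : s < 1) (hpos : 0 < D r) : 0 ≤ D s := by
  -- The supremum c of A splits [0, 1] into a part where D is convex and a part where it is concave.
  set A : Set ℝ := {c | c ∈ Set.Icc (0 : ℝ) 1 ∧ ∀ u, 0 < u → u < c → 0 ≤ D'' u} with hA
  have hA0 : (0 : ℝ) ∈ A := ⟨by simp, fun u hu hu' => by linarith⟩
  have hbdd : BddAbove A := ⟨1, fun c hc => hc.1.2⟩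
  obtain ⟨c, hcdef⟩ : ∃ c, c = sSup A := ⟨_, rfl⟩
  have hc0 : 0 ≤ c := hcdef ▸ le_csSup hbdd hA0
  have hc1 : c ≤ 1 := hcdef ▸ csSup_le ⟨0, hA0⟩ (fun c hc => hc.1.2)
  have hlt : ∀ u, 0 < u → u < c → 0 ≤ D'' u := by
    intro u hu huc
    obtain ⟨v, hv, huv⟩ := exists_lt_of_lt_csSup ⟨0, hA0⟩ (hcdef ▸ huc)
    exact hv.2 u hu huv
  have hgt : ∀ u, c < u → u < 1 → D'' u ≤ 0 := by
    intro u hcu hu1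
    obtain ⟨v, hcv, hvu⟩ := exists_between hcu
    have hv : v ∉ A := fun hv => absurd (le_csSup hbdd hv) (by rw [← hcdef]; linarith)
    have : ∃ w, 0 < w ∧ w < v ∧ D'' w < 0 := by
      by_contra! hw
      exact hv ⟨⟨by linarith, by linarith⟩, hw⟩
    obtain ⟨w, hw0, hwv, hw⟩ := this
    exact hs w u hw0 (by linarith) hu1 hw
  have hconv : ConvexOn ℝ (Set.Icc 0 c) D := by
    refine convexOn_of_hasDerivWithinAt2_nonneg (f' := D') (f'' := D'') (convex_Icc 0 c)
      (hc.mono (Set.Icc_subset_Icc_right hc1)) ?_ ?_ ?_ <;>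
    · rw [interior_Icc]
      intro x hx
      first
      | exact (hD x ⟨hx.1, by linarith [hx.2]⟩).hasDerivWithinAt
      | exact (hD' x ⟨hx.1, by linarith [hx.2]⟩).hasDerivWithinAt
      | exact hlt x hx.1 hx.2
  have hconc : ConcaveOn ℝ (Set.Icc c 1) D := by
    refine concaveOn_of_hasDerivWithinAt2_nonpos (f' := D') (f'' := D'') (convex_Icc c 1)
      (hc.mono (Set.Icc_subset_Icc_left hc0)) ?_ ?_ ?_ <;>
    · rw [interior_Icc]
      intro x hx
      first
      | exact (hD x ⟨by linarith [hx.1], hx.2⟩).hasDerivWithinAt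
      | exact (hD' x ⟨by linarith [hx.1], hx.2⟩).hasDerivWithinAt
      | exact hgt x hx.1 hx.2
  -- Convexity with D(0) = 0 and D(u) < 0 would force D(r) ≤ 0.
  have left : ∀ u, r ≤ u → u ≤ c → 0 ≤ D u := by
    intro u hru huc
    by_contra! hu
    have := hconv.le_max_of_mem_Icc (x := 0) (y := u) (z := r) ⟨le_rfl, hc0⟩ ⟨by linarith, huc⟩
      ⟨hr.le, hru⟩
    rw [h0, max_eq_left hu.le] at this
    linarith
  have right : ∀ u, c ≤ u → u ≤ s → 0 ≤ D u → 0 ≤ D s := by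
    intro u hcu hus hu
    have := hconc.min_le_of_mem_Icc (x := u) (y := 1) (z := s) ⟨hcu, by linarith⟩ ⟨hc1, le_rfl⟩
      ⟨hus, hs1.le⟩
    rw [h1, min_eq_right hu] at this
    exact this
  rcases le_total s c with h | h
  · exact left s hrs.le h
  rcases le_total c r with h' | h'
  · exact right r h' hrs.le hpos.le
  · exact right c le_rfl h (left c h' le_rfl)

/-- If the derivative of `F` has the sign of `D`, and `D` changes sign at most once, from
nonpositive to nonnegative, then `F` is largest at an end of `[0, 1]`. -/
theorem le_max_of_deriv_sign {F D w : ℝ → ℝ} (hF : ContinuousOn F (Set.Icc 0 1))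
    (hw : ∀ r ∈ Set.Ioo (0 : ℝ) 1, 0 < w r)
    (hd : ∀ r ∈ Set.Ioo (0 : ℝ) 1, HasDerivAt F (w r * D r) r)
    (hs : ∀ r s : ℝ, 0 < r → r < s → s < 1 → 0 < D r → 0 ≤ D s)
    {r : ℝ} (hr : r ∈ Set.Icc (0 : ℝ) 1) : F r ≤ max (F 0) (F 1) := by
  by_cases h : ∃ u, 0 < u ∧ u < r ∧ 0 < D u
  · obtain ⟨u, hu0, hur, hu⟩ := h
    refine le_max_of_le_right ?_
    have : MonotoneOn F (Set.Icc r 1) := by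
      refine monotoneOn_of_hasDerivWithinAt_nonneg (f' := fun x => w x * D x) (convex_Icc r 1)
        (hF.mono (Set.Icc_subset_Icc_left hr.1)) ?_ ?_ <;>
      · rw [interior_Icc]
        intro x hx
        have hx' : x ∈ Set.Ioo (0 : ℝ) 1 := ⟨by linarith [hx.1], hx.2⟩
        first
        | exact (hd x hx').hasDerivWithinAt
        | exact mul_nonneg (hw x hx').le (hs u x hu0 (by linarith [hx.1]) hx.2 hu)
    exact this ⟨le_rfl, hr.2⟩ ⟨hr.2, le_rfl⟩ hr.2
  · push Not at h
    refine le_max_of_le_left ?_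
    have : AntitoneOn F (Set.Icc 0 r) := by
      refine antitoneOn_of_hasDerivWithinAt_nonpos (f' := fun x => w x * D x) (convex_Icc 0 r)
        (hF.mono (Set.Icc_subset_Icc_right hr.2)) ?_ ?_ <;>
      · rw [interior_Icc]
        intro x hx
        have hx' : x ∈ Set.Ioo (0 : ℝ) 1 := ⟨hx.1, by linarith [hx.2, hr.2]⟩
        first
        | exact (hd x hx').hasDerivWithinAt
        | exact mul_nonpos_of_nonneg_of_nonpos (hw x hx').le (h x hx.1 hx.2)
    exact this ⟨le_rfl, hr.1⟩ ⟨hr.1, le_rfl⟩ hr.1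

/-! ### The slope function and its first two derivatives -/

/-- Up to a positive factor, the derivative of `powerRatio m q`. -/
noncomputable def powerSlope (m q r : ℝ) : ℝ :=
  (1 + m * r) ^ q * (1 - r) + r ^ q * (2 + m * r) - (1 + (m + 1) * r)

/-- The derivative of `powerSlope m q`. -/
noncomputable def powerSlopeDeriv (m q r : ℝ) : ℝ :=
  q * m * (1 + m * r) ^ (q - 1) * (1 - r) - (1 + m * r) ^ q + q * r ^ (q - 1) * (2 + m * r)
    + r ^ q * m - (m + 1)

/-- The second derivative of `powerSlope m q`. -/
noncomputable def powerSlopeDerivTwo (m q r : ℝ) : ℝ :=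
  q * (r ^ (q - 2) * (2 * (q - 1) + m * (q + 1) * r)
    - m * ((1 + m * r) ^ (q - 2) * ((q + 1) * (1 + m * r) - (m + 1) * (q - 1))))

theorem hasDerivAt_rpow_affine {m r : ℝ} (q : ℝ) (hT : 0 < 1 + m * r) :
    HasDerivAt (fun r : ℝ => (1 + m * r) ^ q) (m * q * (1 + m * r) ^ (q - 1)) r := by
  have h : HasDerivAt (fun r : ℝ => 1 + m * r) m r := by
    simpa using ((hasDerivAt_id r).const_mul m).const_add 1
  exact h.rpow_const (Or.inl hT.ne')

theorem hasDerivAt_powerSlope {m q r : ℝ} (hm : 0 < m) (hr : 0 < r) :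
    HasDerivAt (powerSlope m q) (powerSlopeDeriv m q r) r := by
  have hT : 0 < 1 + m * r := by positivity
  have e1 := hasDerivAt_rpow_affine q hT
  have e2 : HasDerivAt (fun r : ℝ => r ^ q) (q * r ^ (q - 1)) r :=
    Real.hasDerivAt_rpow_const (Or.inl hr.ne')
  have e3 : HasDerivAt (fun r : ℝ => 1 - r) (-1) r := by
    simpa using (hasDerivAt_id r).const_sub 1
  have e4 : HasDerivAt (fun r : ℝ => 2 + m * r) m r := by
    simpa using ((hasDerivAt_id r).const_mul m).const_add 2
  have e5 : HasDerivAt (fun r : ℝ => 1 + (m + 1) * r) (m + 1) r := by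
    simpa using ((hasDerivAt_id r).const_mul (m + 1)).const_add 1
  refine (((e1.mul e3).add (e2.mul e4)).sub e5).congr_deriv ?_
  simp only [powerSlopeDeriv]
  ring

theorem hasDerivAt_powerSlopeDeriv {m q r : ℝ} (hm : 0 < m) (hr : 0 < r) :
    HasDerivAt (powerSlopeDeriv m q) (powerSlopeDerivTwo m q r) r := by
  have hT : 0 < 1 + m * r := by positivity
  have e1 := hasDerivAt_rpow_affine q hT
  have e1' := hasDerivAt_rpow_affine (q - 1) hT
  have e2 : HasDerivAt (fun r : ℝ => r ^ q) (q * r ^ (q - 1)) r :=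
    Real.hasDerivAt_rpow_const (Or.inl hr.ne')
  have e2' : HasDerivAt (fun r : ℝ => r ^ (q - 1)) ((q - 1) * r ^ (q - 1 - 1)) r :=
    Real.hasDerivAt_rpow_const (Or.inl hr.ne')
  have e3 : HasDerivAt (fun r : ℝ => 1 - r) (-1) r := by
    simpa using (hasDerivAt_id r).const_sub 1
  have e4 : HasDerivAt (fun r : ℝ => 2 + m * r) m r := by
    simpa using ((hasDerivAt_id r).const_mul m).const_add 2
  refine ((((((e1'.const_mul (q * m)).mul e3).sub e1).add ((e2'.const_mul q).mul e4)).add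
    (e2.mul_const m)).sub_const (m + 1)).congr_deriv ?_
  have t1 : (1 + m * r) ^ (q - 1) = (1 + m * r) ^ (q - 2) * (1 + m * r) := by
    rw [← Real.rpow_add_one hT.ne']; ring_nf
  have t2 : r ^ (q - 1) = r ^ (q - 2) * r := by
    rw [← Real.rpow_add_one hr.ne']; ring_nf
  simp only [powerSlopeDerivTwo, sub_sub, t1, t2]
  norm_num
  ring

theorem powerSlope_zero {m q : ℝ} (hq : 0 < q) : powerSlope m q 0 = 0 := by
  simp [powerSlope, Real.zero_rpow hq.ne']

theorem powerSlope_one (m q : ℝ) : powerSlope m q 1 = 0 := by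
  simp [powerSlope]; ring

theorem continuousOn_powerSlope {m q : ℝ} (hq : 0 < q) :
    ContinuousOn (powerSlope m q) (Set.Icc 0 1) := by
  unfold powerSlope
  refine ContinuousOn.sub (ContinuousOn.add (ContinuousOn.mul ?_ (by fun_prop))
    (ContinuousOn.mul ?_ (by fun_prop))) (by fun_prop)
  · exact ContinuousOn.rpow_const (by fun_prop) (fun _ _ => Or.inr hq.le)
  · exact ContinuousOn.rpow_const (by fun_prop) (fun _ _ => Or.inr hq.le)

/-! ### Sign of the second derivative through a monotone quotient -/

/-- The quotient of the two terms of `powerSlopeDerivTwo m q` (without the factor `m`). -/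
noncomputable def powerSlopeQuot (m q r : ℝ) : ℝ :=
  r ^ (q - 2) * (1 + m * r) ^ (2 - q) * (2 * (q - 1) + m * (q + 1) * r) /
    ((q + 1) * (1 + m * r) - (m + 1) * (q - 1))

/-- The sign-carrying factor of the derivative of `powerSlopeQuot m q`. -/
def powerSlopeQuotFactor (m q r : ℝ) : ℝ :=
  (q - 2) * (2 * (q - 1) + m * (q + 1) * r) * ((q + 1) * (1 + m * r) - (m + 1) * (q - 1))
    + r * (1 + m * r) * (m * (q + 1)) * ((q + 1) - (m + 3) * (q - 1))

theorem powerSlopeQuotFactor_eq (m q r : ℝ) : powerSlopeQuotFactor m q r =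
    (1 - q) * ((q + 1) * (m + 2 - q) * (m * r) ^ 2
      + (q + 1) * (4 - 2 * q + m * (q - 1)) * (m * r) + 2 * (2 - q) * (m + 2 - m * q)) := by
  unfold powerSlopeQuotFactor; ring

theorem powerSlopeQuotFactor_nonneg {m q r : ℝ} (hm : 0 < m) (hq0 : 0 < q) (hq1 : q < 1) (hr : 0 < r) :
    0 ≤ powerSlopeQuotFactor m q r := by
  rw [powerSlopeQuotFactor_eq]
  refine mul_nonneg (by linarith) ?_
  have hR : 0 < m * r := by positivity
  set R := m * r
  -- The only negative contribution is -m(1-q)R; it is absorbed by R² - R + 1 > 0, borrowing from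
  -- the quadratic and constant terms.
  have h2 : 0 ≤ m * (1 - q) * (R ^ 2 - R + 1) := by
    have : 0 ≤ 1 - q := by linarith
    have : 0 ≤ R ^ 2 - R + 1 := by nlinarith [sq_nonneg (R - 1)]
    positivity
  have h3 : 0 ≤ (q + 1) * ((m * q + 2 - q) * R ^ 2 + (4 - 2 * q) * R) := by
    have : 0 ≤ 2 - q := by linarith
    have : 0 ≤ 4 - 2 * q := by linarith
    have : 0 ≤ m * q := by positivity
    have : 0 ≤ m * q + 2 - q := by linarith
    positivity
  have h4 : 0 ≤ (q + 1) * (m * (1 - q) * (R ^ 2 - R + 1)) := mul_nonneg (by linarith) h2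
  have h6 : 0 ≤ m * (1 - q) * (2 * (2 - q) - (q + 1)) := by
    have : 0 ≤ 1 - q := by linarith
    have : 0 ≤ 2 * (2 - q) - (q + 1) := by linarith
    positivity
  nlinarith [h3, h4, h6]

theorem powerSlopeQuotFactor_nonpos {m q r : ℝ} (hm : 0 < m) (hq1 : 1 < q) (hq2 : q < 2) (hr : 0 < r)
    (hY : 0 < (q + 1) * (1 + m * r) - (m + 1) * (q - 1)) :
    powerSlopeQuotFactor m q r ≤ 0 := by
  have h1 : 0 < q - 1 := by linarith
  have h2 : 0 < 2 - q := by linarith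
  -- In the first case every coefficient of the expansion in m r is nonnegative; in the second both
  -- summands of the definition are nonpositive.
  rcases le_total 0 ((q + 1) - (m + 3) * (q - 1)) with h | h
  · rw [powerSlopeQuotFactor_eq]
    refine mul_nonpos_of_nonpos_of_nonneg (by linarith) ?_
    have e1 : 0 ≤ m + 2 - q := by linarith
    have e2 : 0 ≤ 4 - 2 * q + m * (q - 1) := by nlinarith
    have e3 : 0 ≤ m + 2 - m * q := by nlinarith
    positivity
  · unfold powerSlopeQuotFactor
    refine add_nonpos ?_ ?_
    · refine mul_nonpos_of_nonpos_of_nonneg ?_ hY.le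
      refine mul_nonpos_of_nonpos_of_nonneg (by linarith) (by positivity)
    · exact mul_nonpos_of_nonneg_of_nonpos (by positivity) h

theorem hasDerivAt_powerSlopeQuot {m q r : ℝ} (hm : 0 < m) (hr : 0 < r)
    (hY : (q + 1) * (1 + m * r) - (m + 1) * (q - 1) ≠ 0) :
    HasDerivAt (powerSlopeQuot m q) (r ^ (q - 3) * (1 + m * r) ^ (1 - q) * powerSlopeQuotFactor m q r /
      ((q + 1) * (1 + m * r) - (m + 1) * (q - 1)) ^ 2) r := by
  have hT : 0 < 1 + m * r := by positivity
  have e1 := hasDerivAt_rpow_affine (2 - q) hT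
  have e2 : HasDerivAt (fun r : ℝ => r ^ (q - 2)) ((q - 2) * r ^ (q - 2 - 1)) r :=
    Real.hasDerivAt_rpow_const (Or.inl hr.ne')
  have e3 : HasDerivAt (fun r : ℝ => 2 * (q - 1) + m * (q + 1) * r) (m * (q + 1)) r := by
    simpa using ((hasDerivAt_id r).const_mul (m * (q + 1))).const_add (2 * (q - 1))
  have e4 : HasDerivAt (fun r : ℝ => (q + 1) * (1 + m * r) - (m + 1) * (q - 1))
      ((q + 1) * m) r := by
    simpa using ((((hasDerivAt_id r).const_mul m).const_add 1).const_mul (q + 1)).sub_const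
      ((m + 1) * (q - 1))
  refine (((e2.mul e1).mul e3).div e4 hY).congr_deriv ?_
  have t1 : (1 + m * r) ^ (2 - q) = (1 + m * r) ^ (1 - q) * (1 + m * r) := by
    rw [← Real.rpow_add_one hT.ne']; ring_nf
  have t1' : (1 + m * r) ^ (2 - q - 1) = (1 + m * r) ^ (1 - q) := by ring_nf
  have t2 : r ^ (q - 2) = r ^ (q - 3) * r := by
    rw [← Real.rpow_add_one hr.ne']; ring_nf
  have t2' : r ^ (q - 2 - 1) = r ^ (q - 3) := by ring_nf
  simp only [t1, t1', t2, t2', Pi.mul_apply]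
  congr 1
  simp only [powerSlopeQuotFactor]
  ring

theorem powerSlopeDerivTwo_eq {m q r : ℝ} (hm : 0 < m) (hr : 0 < r)
    (hY : (q + 1) * (1 + m * r) - (m + 1) * (q - 1) ≠ 0) :
    powerSlopeDerivTwo m q r = q * (1 + m * r) ^ (q - 2) *
      ((q + 1) * (1 + m * r) - (m + 1) * (q - 1)) * (powerSlopeQuot m q r - m) := by
  have hT : 0 < 1 + m * r := by positivity
  have : (1 + m * r) ^ (q - 2) * (1 + m * r) ^ (2 - q) = 1 := by
    rw [← Real.rpow_add hT]; simp
  unfold powerSlopeDerivTwo powerSlopeQuot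
  generalize (q + 1) * (1 + m * r) - (m + 1) * (q - 1) = Y at *
  field_simp
  linear_combination (-q * r ^ (q - 2) * (2 * (q - 1) + m * r * (q + 1))) * this

/-- Where its denominator is positive, the quotient decreases, so once below m it stays below; the
second derivative has the sign of quotient minus m. -/
theorem powerSlopeDerivTwo_nonpos_of_neg {m q : ℝ} (hm : 0 < m) (hq1 : 1 < q) (hq2 : q < 2)
    {r s : ℝ} (hr : 0 < r) (hrs : r < s) (h : powerSlopeDerivTwo m q r < 0) :
    powerSlopeDerivTwo m q s ≤ 0 := by
  have hq : 0 < q := by linarith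
  -- With a nonpositive denominator the second derivative would be positive. The denominator
  -- increases with r, so it stays positive from r on.
  have hY : 0 < (q + 1) * (1 + m * r) - (m + 1) * (q - 1) := by
    by_contra! hY
    have h1 : 0 < q - 1 := by linarith
    have : 0 < r ^ (q - 2) * (2 * (q - 1) + m * (q + 1) * r) := by positivity
    have h2 : (1 + m * r) ^ (q - 2) * ((q + 1) * (1 + m * r) - (m + 1) * (q - 1)) ≤ 0 :=
      mul_nonpos_of_nonneg_of_nonpos (by positivity) hY
    have : 0 < powerSlopeDerivTwo m q r := mul_pos hq (by nlinarith)
    linarith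
  have hY' : ∀ u, r ≤ u → 0 < (q + 1) * (1 + m * u) - (m + 1) * (q - 1) := by
    intro u hu
    have : (q + 1) * (1 + m * r) ≤ (q + 1) * (1 + m * u) := by gcongr
    linarith
  have hs : 0 < s := hr.trans hrs
  have hanti : AntitoneOn (powerSlopeQuot m q) (Set.Icc r s) := by
    refine antitoneOn_of_hasDerivWithinAt_nonpos (convex_Icc r s)
      (fun x hx => (hasDerivAt_powerSlopeQuot hm (hr.trans_le hx.1)
        (hY' x hx.1).ne').continuousAt.continuousWithinAt)
      (fun x hx => (hasDerivAt_powerSlopeQuot hm ?_ ?_).hasDerivWithinAt) (fun x hx => ?_) <;>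
    rw [interior_Icc] at hx
    · exact hr.trans hx.1
    · exact (hY' x hx.1.le).ne'
    · have hx0 : 0 < x := hr.trans hx.1
      refine div_nonpos_of_nonpos_of_nonneg (mul_nonpos_of_nonneg_of_nonpos (by positivity)
        (powerSlopeQuotFactor_nonpos hm hq1 hq2 hx0 (hY' x hx.1.le))) (by positivity)
  have hle := hanti ⟨le_rfl, hrs.le⟩ ⟨hrs.le, le_rfl⟩ hrs.le
  rw [powerSlopeDerivTwo_eq hm hr hY.ne'] at h
  rw [powerSlopeDerivTwo_eq hm hs (hY' s hrs.le).ne']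
  have h' : powerSlopeQuot m q r - m < 0 := by
    by_contra! h'
    have : 0 ≤ q * (1 + m * r) ^ (q - 2) *
      ((q + 1) * (1 + m * r) - (m + 1) * (q - 1)) * (powerSlopeQuot m q r - m) := by positivity
    linarith
  have := hY' s hrs.le
  exact mul_nonpos_of_nonneg_of_nonpos (by positivity) (by linarith)

/-- For q < 1 the denominator is positive throughout and the quotient increases, which reverses the
sign pattern. -/
theorem powerSlopeDerivTwo_nonneg_of_pos {m q : ℝ} (hm : 0 < m) (hq : 0 < q) (hq1 : q < 1)
    {r s : ℝ} (hr : 0 < r) (hrs : r < s) (h : 0 < powerSlopeDerivTwo m q r) :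
    0 ≤ powerSlopeDerivTwo m q s := by
  have hY : ∀ u, 0 < u → 0 < (q + 1) * (1 + m * u) - (m + 1) * (q - 1) := by
    intro u hu
    have h1 : 0 < (q + 1) * (1 + m * u) := by positivity
    have h2 : 0 < (m + 1) * (1 - q) := mul_pos (by linarith) (by linarith)
    linarith
  have hs : 0 < s := hr.trans hrs
  have hmono : MonotoneOn (powerSlopeQuot m q) (Set.Icc r s) := by
    refine monotoneOn_of_hasDerivWithinAt_nonneg (convex_Icc r s)
      (fun x hx => (hasDerivAt_powerSlopeQuot hm (hr.trans_le hx.1)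
        (hY x (hr.trans_le hx.1)).ne').continuousAt.continuousWithinAt)
      (fun x hx => (hasDerivAt_powerSlopeQuot hm ?_ ?_).hasDerivWithinAt) (fun x hx => ?_) <;>
    rw [interior_Icc] at hx
    · exact hr.trans hx.1
    · exact (hY x (hr.trans hx.1)).ne'
    · have hx0 : 0 < x := hr.trans hx.1
      have := powerSlopeQuotFactor_nonneg hm hq hq1 hx0
      positivity
  have hle := hmono ⟨le_rfl, hrs.le⟩ ⟨hrs.le, le_rfl⟩ hrs.le
  have hYr := hY r hr
  have hYs := hY s hs
  rw [powerSlopeDerivTwo_eq hm hr hYr.ne'] at h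
  rw [powerSlopeDerivTwo_eq hm hs hYs.ne']
  have h' : 0 < powerSlopeQuot m q r - m := pos_of_mul_pos_right h (by positivity)
  have : 0 ≤ powerSlopeQuot m q s - m := by linarith
  positivity

/-! ### Convexity in the exponent and the single sign change -/

theorem convexOn_powerSlope {m r : ℝ} (hm : 0 < m) (hr : 0 < r) (hr1 : r < 1) :
    ConvexOn ℝ Set.univ (fun q => powerSlope m q r) := by
  unfold powerSlope
  have hT : 0 < 1 + m * r := by positivity
  have h1 : ConvexOn ℝ Set.univ (fun q : ℝ => (1 + m * r) ^ q * (1 - r)) := by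
    simpa [mul_comm] using (convexOn_rpow_left hT).smul (show 0 ≤ 1 - r by linarith)
  have h2 : ConvexOn ℝ Set.univ (fun q : ℝ => r ^ q * (2 + m * r)) := by
    simpa [mul_comm] using (convexOn_rpow_left hr).smul (show 0 ≤ 2 + m * r by positivity)
  exact (h1.add h2).sub (concaveOn_const _ convex_univ)

theorem powerSlope_of_exponent_one (m r : ℝ) : powerSlope m 1 r = 0 := by
  simp [powerSlope]; ring

/-- A convex function of q that vanishes at q = 1 cannot become negative after being nonnegative at
some q > 1. -/
theorem powerSlope_nonneg_of_le {m q q' r : ℝ} (hm : 0 < m) (hr : 0 < r) (hr1 : r < 1) (hq : 1 < q)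
    (hqq : q ≤ q') (h : 0 ≤ powerSlope m q r) : 0 ≤ powerSlope m q' r := by
  have := (convexOn_powerSlope hm hr hr1).le_max_of_mem_Icc (x := 1) (y := q') (z := q)
    trivial trivial ⟨hq.le, hqq⟩
  simp only [powerSlope_of_exponent_one] at this
  by_contra! hneg
  rw [max_eq_left hneg.le] at this
  -- The value at q is squeezed to 0, but the chord from 0 at exponent 1 to a negative value at q'
  -- is strictly negative at q.
  have hz : powerSlope m q r = 0 := le_antisymm this h
  obtain ⟨a, b, ha, hb, hab, hcomb⟩ : ∃ a b : ℝ, 0 ≤ a ∧ 0 < b ∧ a + b = 1 ∧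
      a * 1 + b * q' = q := by
    have h0 : 0 < q' - 1 := by linarith
    refine ⟨(q' - q) / (q' - 1), (q - 1) / (q' - 1), div_nonneg (by linarith) h0.le,
      div_pos (by linarith) h0, ?_, ?_⟩ <;> field_simp <;> ring
  have h2 := (convexOn_powerSlope hm hr hr1).2 (x := 1) (y := q') trivial trivial ha hb.le hab
  simp only [smul_eq_mul, hcomb, powerSlope_of_exponent_one] at h2
  nlinarith

theorem powerSlope_nonpos_of_mem_Icc {m q q' r : ℝ} (hm : 0 < m) (hr : 0 < r) (hr1 : r < 1)
    (hq : 1 ≤ q) (hqq : q ≤ q') (h : powerSlope m q' r ≤ 0) : powerSlope m q r ≤ 0 := by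
  have := (convexOn_powerSlope hm hr hr1).le_max_of_mem_Icc (x := 1) (y := q') (z := q)
    trivial trivial ⟨hq, hqq⟩
  simp only [powerSlope_of_exponent_one] at this
  rwa [max_eq_left h] at this

theorem powerSlope_exponent_two_nonneg {m r : ℝ} (hm : 2 ≤ m) (hr : 0 < r) (hr1 : r < 1) :
    0 ≤ powerSlope m 2 r := by
  have : powerSlope m 2 r = r * (1 - r) * ((m - 2) + (m ^ 2 - m) * r) := by
    simp only [powerSlope, Real.rpow_two]; ring
  rw [this]
  have h1 : 0 ≤ 1 - r := by linarith
  have h2 : 0 ≤ m - 2 := by linarith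
  have h3 : 0 ≤ m ^ 2 - m := by nlinarith
  positivity

/-- This is d = 3, α = 2, where ∑ x_i⁴ = 1/2 on all zero-sum unit vectors. -/
theorem powerSlope_one_exponent_three (r : ℝ) : powerSlope 1 3 r = 0 := by
  have h : ∀ x : ℝ, x ^ (3 : ℝ) = x ^ 3 := fun x => by exact_mod_cast Real.rpow_natCast x 3
  simp only [powerSlope, h]; ring

/-- For 1 < q < 2 the second derivative changes sign at most once. For q ≥ 2 convexity in q fixes
the sign on all of (0, 1), starting from q = 2 when m ≥ 2; for m = 1 the sign switches at q = 3
instead. -/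
theorem powerSlope_nonneg_of_pos {m q : ℝ} (hm : m = 1 ∨ 2 ≤ m) (hq : 1 < q) {r s : ℝ} (hr : 0 < r)
    (hrs : r < s) (hs : s < 1) (h : 0 < powerSlope m q r) : 0 ≤ powerSlope m q s := by
  have hm0 : 0 < m := by rcases hm with h | h <;> linarith
  have hs0 : 0 < s := hr.trans hrs
  rcases lt_or_ge q 2 with hq2 | hq2
  · exact nonneg_of_pos_of_deriv2_sign (continuousOn_powerSlope (by linarith))
      (powerSlope_zero (by linarith)) (powerSlope_one m q) (fun x hx => hasDerivAt_powerSlope hm0 hx.1)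
      (fun x hx => hasDerivAt_powerSlopeDeriv hm0 hx.1)
      (fun u v hu huv _ => powerSlopeDerivTwo_nonpos_of_neg hm0 hq hq2 hu huv) hr hrs hs h
  rcases hm with rfl | hm
  · rcases le_total q 3 with hq3 | hq3
    · exact absurd (powerSlope_nonpos_of_mem_Icc one_pos hr (hrs.trans hs) hq.le hq3
        (powerSlope_one_exponent_three r).le) (by linarith)
    · exact powerSlope_nonneg_of_le one_pos hs0 hs (by norm_num) hq3 (powerSlope_one_exponent_three s).ge
  · exact powerSlope_nonneg_of_le hm0 hs0 hs (by norm_num) hq2 (powerSlope_exponent_two_nonneg hm hs0 hs)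

theorem powerSlope_nonpos_of_neg {m q : ℝ} (hm : 0 < m) (hq : 0 < q) (hq1 : q < 1) {r s : ℝ}
    (hr : 0 < r) (hrs : r < s) (hs : s < 1) (h : powerSlope m q r < 0) : powerSlope m q s ≤ 0 := by
  have := nonneg_of_pos_of_deriv2_sign (D := fun r => -powerSlope m q r)
    (D' := fun r => -powerSlopeDeriv m q r) (D'' := fun r => -powerSlopeDerivTwo m q r)
    (continuousOn_powerSlope hq).neg (by simp [powerSlope_zero hq]) (by simp [powerSlope_one])
    (fun x hx => (hasDerivAt_powerSlope hm hx.1).neg)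
    (fun x hx => (hasDerivAt_powerSlopeDeriv hm hx.1).neg)
    (fun u v hu huv _ huneg => by
      have := powerSlopeDerivTwo_nonneg_of_pos hm hq hq1 hu huv (by linarith)
      linarith) hr hrs hs (by linarith)
  linarith

/-! ### The one-parameter family -/

/-- The sum of the `(q + 1)`-th powers of the absolute values of the entries of
`(1 + m r, -1, -r, …, -r)`, with `m` entries `-r`, after normalisation in the Euclidean norm. -/
noncomputable def powerRatio (m q r : ℝ) : ℝ :=
  ((1 + m * r) ^ (q + 1) + 1 + m * r ^ (q + 1)) *
    ((1 + m * r) ^ 2 + 1 + m * r ^ 2) ^ (-(q + 1) / 2)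

theorem hasDerivAt_powerRatio {m q r : ℝ} (hm : 0 < m) (hr : 0 < r) :
    HasDerivAt (powerRatio m q) ((q + 1) * m *
      ((1 + m * r) ^ 2 + 1 + m * r ^ 2) ^ (-(q + 1) / 2 - 1) * powerSlope m q r) r := by
  have hT : 0 < 1 + m * r := by positivity
  have hQ : 0 < (1 + m * r) ^ 2 + 1 + m * r ^ 2 := by positivity
  have e1 := hasDerivAt_rpow_affine (q + 1) hT
  have e2 : HasDerivAt (fun r : ℝ => r ^ (q + 1)) ((q + 1) * r ^ (q + 1 - 1)) r :=
    Real.hasDerivAt_rpow_const (Or.inl hr.ne')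
  have e3 : HasDerivAt (fun r : ℝ => (1 + m * r) ^ 2 + 1 + m * r ^ 2)
      (2 * (1 + m * r) * m + m * (2 * r)) r := by
    have h : HasDerivAt (fun r : ℝ => 1 + m * r) m r := by
      simpa using ((hasDerivAt_id r).const_mul m).const_add 1
    have h2 : HasDerivAt (fun r : ℝ => r ^ 2) (2 * r) r := by
      simpa using hasDerivAt_pow 2 r
    exact (((h.pow 2).add_const 1).add (h2.const_mul m)).congr_deriv (by norm_num)
  have e4 := e3.rpow_const (p := -(q + 1) / 2) (Or.inl hQ.ne')
  refine (((e1.add_const 1).add (e2.const_mul m)).mul e4).congr_deriv ?_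
  have t1 : (1 + m * r) ^ (q + 1) = (1 + m * r) ^ q * (1 + m * r) := Real.rpow_add_one hT.ne' q
  have t2 : r ^ (q + 1) = r ^ q * r := Real.rpow_add_one hr.ne' q
  have t3 : ((1 + m * r) ^ 2 + 1 + m * r ^ 2) ^ (-(q + 1) / 2) =
      ((1 + m * r) ^ 2 + 1 + m * r ^ 2) ^ (-(q + 1) / 2 - 1) *
        ((1 + m * r) ^ 2 + 1 + m * r ^ 2) := by
    rw [← Real.rpow_add_one hQ.ne']; ring_nf
  simp only [t1, t2, t3, add_sub_cancel_right, powerSlope, Pi.add_apply]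
  ring

theorem continuousOn_powerRatio {m q : ℝ} (hm : 0 < m) (hq : 0 < q) :
    ContinuousOn (powerRatio m q) (Set.Icc 0 1) := by
  have hq' : 0 ≤ q + 1 := by linarith
  unfold powerRatio
  refine ContinuousOn.mul (ContinuousOn.add (ContinuousOn.add ?_ (by fun_prop))
    (ContinuousOn.mul (by fun_prop) ?_)) ?_
  · exact ContinuousOn.rpow_const (by fun_prop) (fun _ _ => Or.inr hq')
  · exact ContinuousOn.rpow_const (by fun_prop) (fun _ _ => Or.inr hq')
  · refine ContinuousOn.rpow_const (by fun_prop) (fun x hx => Or.inl ?_)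
    positivity

theorem powerRatio_le_max {m q r : ℝ} (hm : m = 1 ∨ 2 ≤ m) (hq : 1 < q)
    (hr : r ∈ Set.Icc (0 : ℝ) 1) :
    powerRatio m q r ≤ max (powerRatio m q 0) (powerRatio m q 1) := by
  have hm0 : 0 < m := by rcases hm with h | h <;> linarith
  exact le_max_of_deriv_sign (continuousOn_powerRatio hm0 (by linarith))
    (fun x hx => by positivity) (fun x hx => hasDerivAt_powerRatio hm0 hx.1)
    (fun u v hu huv hv => powerSlope_nonneg_of_pos hm hq hu huv hv) hr

theorem min_le_powerRatio {m q r : ℝ} (hm : 0 < m) (hq : 0 < q) (hq1 : q < 1)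
    (hr : r ∈ Set.Icc (0 : ℝ) 1) :
    min (powerRatio m q 0) (powerRatio m q 1) ≤ powerRatio m q r := by
  have := le_max_of_deriv_sign (F := fun r => -powerRatio m q r) (D := fun r => -powerSlope m q r)
    (continuousOn_powerRatio hm hq).neg
    (w := fun r => (q + 1) * m * ((1 + m * r) ^ 2 + 1 + m * r ^ 2) ^ (-(q + 1) / 2 - 1))
    (fun x hx => by positivity)
    (fun x hx => (hasDerivAt_powerRatio hm hx.1).neg.congr_deriv (by ring))
    (fun u v hu huv hv h => by
      have := powerSlope_nonpos_of_neg hm hq hq1 hu huv hv (by linarith)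
      linarith) hr
  rw [max_neg_neg] at this
  linarith

/-! ### Reduction to two-level vectors by a quadratic majorant -/

/-- If `f'` is convex on `[0, ∞)` and vanishes at `0`, the quadratic polynomial which touches `f` at
`b` and meets it at `a > b` majorises `f` on `[0, a]`, and its linear coefficient is nonpositive. -/
theorem exists_quadratic_majorant {f f' : ℝ → ℝ} (hf : ∀ y, 0 ≤ y → HasDerivAt f (f' y) y)
    (hconv : ConvexOn ℝ (Set.Ici 0) f') (h0 : f' 0 = 0) {a b : ℝ} (hb : 0 ≤ b) (hab : b < a) :
    ∃ A B C : ℝ, B ≤ 0 ∧ f a = A + B * a + C * a ^ 2 ∧ f b = A + B * b + C * b ^ 2 ∧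
      ∀ y ∈ Set.Icc 0 a, f y ≤ A + B * y + C * y ^ 2 := by
  obtain ⟨C, hC⟩ : ∃ C, C * (a - b) ^ 2 = f a - f b - f' b * (a - b) :=
    ⟨_, div_mul_cancel₀ _ (pow_ne_zero 2 (sub_pos.2 hab).ne')⟩
  obtain ⟨B, hB⟩ : ∃ B, B = f' b - 2 * C * b := ⟨_, rfl⟩
  obtain ⟨A, hA⟩ : ∃ A, A = f b - B * b - C * b ^ 2 := ⟨_, rfl⟩
  have hfa : f a = A + B * a + C * a ^ 2 := by rw [hA, hB]; linear_combination -hC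
  have hfb : f b = A + B * b + C * b ^ 2 := by rw [hA]; ring
  set h : ℝ → ℝ := fun y => f y - (A + B * y + C * y ^ 2) with hh
  set g : ℝ → ℝ := fun y => f' y - (B + 2 * C * y) with hg
  have hd : ∀ y, 0 ≤ y → HasDerivAt h (g y) y := by
    intro y hy
    have e1 : HasDerivAt (fun y : ℝ => B * y) B y := by
      simpa using (hasDerivAt_id y).const_mul B
    have e2 : HasDerivAt (fun y : ℝ => C * y ^ 2) (C * (2 * y)) y := by
      simpa using (hasDerivAt_pow 2 y).const_mul C
    exact ((hf y hy).sub ((e1.const_add A).add e2)).congr_deriv (by simp only [hg]; ring)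
  have hcont : ContinuousOn h (Set.Ici 0) := fun y hy => (hd y hy).continuousAt.continuousWithinAt
  have hgconv : ConvexOn ℝ (Set.Ici 0) g := by
    refine hconv.sub ⟨convex_Ici 0, fun x _ y _ u v _ _ huv => le_of_eq ?_⟩
    simp only [smul_eq_mul]
    linear_combination B * huv
  have hgb : g b = 0 := by simp only [hg, hB]; ring
  have hha : h a = 0 := by simp only [hh, hfa]; ring
  have hhb : h b = 0 := by simp only [hh]; linarith
  -- Rolle gives the convex function g = h' a second zero c > b; so g is nonnegative before b,
  -- nonpositive on [b, c] and nonnegative after c.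
  obtain ⟨c, ⟨hbc, hca⟩, hgc⟩ := exists_hasDerivAt_eq_zero (f := h) (f' := g) hab
    (hcont.mono fun y hy => hb.trans hy.1) (hhb.trans hha.symm)
    (fun y hy => hd y (hb.trans hy.1.le))
  have hc : 0 ≤ c := hb.trans hbc.le
  have left : ∀ y, 0 ≤ y → y < b → 0 ≤ g y := by
    intro y hy hyb
    have := hgconv.slope_mono_adjacent (x := y) (y := b) (z := c) hy hc hyb hbc
    rw [hgb, hgc, sub_zero, zero_div, div_nonpos_iff] at this
    rcases this with h | h <;> linarith [h.1, h.2]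
  have mid : ∀ y, b ≤ y → y ≤ c → g y ≤ 0 := by
    intro y hby hyc
    have := hgconv.le_max_of_mem_Icc (x := b) (y := c) (z := y) hb hc ⟨hby, hyc⟩
    rwa [hgb, hgc, max_self] at this
  have right : ∀ y, c < y → 0 ≤ g y := by
    intro y hcy
    have := hgconv.slope_mono_adjacent (x := b) (y := c) (z := y) hb (hc.trans hcy.le) hbc hcy
    rw [hgb, hgc, sub_zero, zero_div, sub_zero] at this
    by_contra! hneg
    have := div_neg_of_neg_of_pos hneg (sub_pos.2 hcy)
    linarith
  refine ⟨A, B, C, ?_, hfa, hfb, fun y hy => ?_⟩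
  -- Since f'(0) = 0, g(0) = -B.
  · have : 0 ≤ g 0 := by
      rcases hb.eq_or_lt with hb0 | hb0
      · exact (hb0 ▸ hgb : g 0 = 0).ge
      · exact left 0 le_rfl hb0
    simp only [hg, h0] at this
    linarith
  suffices h y ≤ 0 by simp only [hh] at this; linarith
  rcases le_total y b with hyb | hyb
  · have : MonotoneOn h (Set.Icc 0 b) := by
      refine monotoneOn_of_hasDerivWithinAt_nonneg (f' := g) (convex_Icc 0 b)
        (hcont.mono fun y hy => hy.1) ?_ ?_ <;> rw [interior_Icc]
      · exact fun x hx => (hd x hx.1.le).hasDerivWithinAt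
      · exact fun x hx => left x hx.1.le hx.2
    exact (this ⟨hy.1, hyb⟩ ⟨hb, le_rfl⟩ hyb).trans_eq hhb
  rcases le_total y c with hyc | hyc
  · have : AntitoneOn h (Set.Icc b c) := by
      refine antitoneOn_of_hasDerivWithinAt_nonpos (f' := g) (convex_Icc b c)
        (hcont.mono fun y hy => hb.trans hy.1) ?_ ?_ <;> rw [interior_Icc]
      · exact fun x hx => (hd x (hb.trans hx.1.le)).hasDerivWithinAt
      · exact fun x hx => mid x hx.1.le hx.2.le
    exact (this ⟨le_rfl, hbc.le⟩ ⟨hyb, hyc⟩ hyb).trans_eq hhb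
  · have : MonotoneOn h (Set.Icc c a) := by
      refine monotoneOn_of_hasDerivWithinAt_nonneg (f' := g) (convex_Icc c a)
        (hcont.mono fun y hy => hc.trans hy.1) ?_ ?_ <;> rw [interior_Icc]
      · exact fun x hx => (hd x (hc.trans hx.1.le)).hasDerivWithinAt
      · exact fun x hx => right x hx.1
    exact (this ⟨hyc, hy.2⟩ ⟨hca.le, le_rfl⟩ hy.2).trans_eq hha

/-- Sum the majorant over s: B ≤ 0 allows B|z| ≤ -B·(-z) = Bz, and the two moments then determine
the total, with equality at the levels a and b. -/
theorem sum_abs_le_of_moments {ι : Type*} {f f' : ℝ → ℝ}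
    (hf : ∀ y, 0 ≤ y → HasDerivAt f (f' y) y) (hconv : ConvexOn ℝ (Set.Ici 0) f') (h0 : f' 0 = 0)
    {s : Finset ι} {z : ι → ℝ} {m a b : ℝ} (hcard : (s.card : ℝ) = m + 1) (hb : 0 ≤ b)
    (hab : b ≤ a) (h1 : ∑ i ∈ s, z i = a + m * b) (h2 : ∑ i ∈ s, z i ^ 2 = a ^ 2 + m * b ^ 2)
    (hz : ∀ i ∈ s, |z i| ≤ a) : ∑ i ∈ s, f |z i| ≤ f a + m * f b := by
  rcases hab.eq_or_lt with rfl | hlt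
  -- When a = b, all z i are at most their mean b, hence equal to it.
  · have hsum : ∑ i ∈ s, (b - z i) = 0 := by
      rw [Finset.sum_sub_distrib, h1, Finset.sum_const, nsmul_eq_mul, hcard]; ring
    have hall := (Finset.sum_eq_zero_iff_of_nonneg
      (fun i hi => sub_nonneg.2 ((le_abs_self _).trans (hz i hi)))).1 hsum
    have : ∑ i ∈ s, f |z i| = ∑ _i ∈ s, f b := Finset.sum_congr rfl fun i hi => by
      rw [← sub_eq_zero.1 (hall i hi), abs_of_nonneg hb]
    rw [this, Finset.sum_const, nsmul_eq_mul, hcard]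
    linarith
  · obtain ⟨A, B, C, hB, hfa, hfb, hle⟩ := exists_quadratic_majorant hf hconv h0 hb hlt
    calc ∑ i ∈ s, f |z i| ≤ ∑ i ∈ s, (A + B * z i + C * z i ^ 2) := by
          refine Finset.sum_le_sum fun i hi => (hle _ ⟨abs_nonneg _, hz i hi⟩).trans ?_
          rw [sq_abs]
          have := mul_le_mul_of_nonpos_left (le_abs_self (z i)) hB
          linarith
      _ = f a + m * f b := by
          rw [Finset.sum_add_distrib, Finset.sum_add_distrib, ← Finset.mul_sum, ← Finset.mul_sum,
            Finset.sum_const, nsmul_eq_mul, hcard, h1, h2, hfa, hfb]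
          ring

/-- The levels solve the two moment equations. Cauchy–Schwarz on s makes the discriminant
nonnegative, and on s without i it gives |z i| ≤ a; t² ≥ 1/2 gives b ≥ 0. -/
theorem exists_two_level {ι : Type*} [DecidableEq ι] {s : Finset ι} {z : ι → ℝ} {m t : ℝ}
    (hm : 0 < m) (hcard : (s.card : ℝ) = m + 1) (ht : 0 < t) (ht2 : 1 - t ^ 2 ≤ t ^ 2)
    (h1 : ∑ i ∈ s, z i = t) (h2 : ∑ i ∈ s, z i ^ 2 = 1 - t ^ 2) :
    ∃ a b : ℝ, 0 < a ∧ 0 ≤ b ∧ b ≤ a ∧ a + m * b = t ∧ a ^ 2 + m * b ^ 2 = 1 - t ^ 2 ∧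
      ∀ i ∈ s, |z i| ≤ a := by
  have hcs := sq_sum_le_card_mul_sum_sq (s := s) (f := z)
  rw [h1, h2, hcard] at hcs
  obtain ⟨w, hw0, hw⟩ : ∃ w : ℝ, 0 ≤ w ∧ m * w ^ 2 = (m + 1) * (1 - t ^ 2) - t ^ 2 := by
    have : 0 ≤ ((m + 1) * (1 - t ^ 2) - t ^ 2) / m := div_nonneg (by linarith) hm.le
    exact ⟨_, Real.sqrt_nonneg _, by rw [Real.sq_sqrt this]; field_simp⟩
  have hwt : w ≤ t := by
    refine abs_le_of_sq_le_sq' ?_ ht.le |>.2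
    have : m * w ^ 2 ≤ m * t ^ 2 := by nlinarith
    exact le_of_mul_le_mul_left this hm
  have hm1 : 0 < m + 1 := by linarith
  refine ⟨(t + m * w) / (m + 1), (t - w) / (m + 1), by positivity,
    div_nonneg (by linarith) hm1.le, ?_, ?_, ?_, ?_⟩
  · gcongr
    nlinarith
  · field_simp; ring
  · field_simp
    linear_combination m * hw + hw
  · intro i hi
    have hcs := sq_sum_le_card_mul_sum_sq (s := s.erase i) (f := z)
    have e1 := Finset.add_sum_erase s z hi
    have e2 := Finset.add_sum_erase s (fun i => z i ^ 2) hi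
    have e3 : ((s.erase i).card : ℝ) = m := by
      have := Finset.card_erase_add_one hi
      have : ((s.erase i).card : ℝ) + 1 = s.card := by exact_mod_cast this
      linarith
    rw [e3, show ∑ j ∈ s.erase i, z j = t - z i by linarith,
      show ∑ j ∈ s.erase i, z j ^ 2 = 1 - t ^ 2 - z i ^ 2 by linarith] at hcs
    have hsq : ((m + 1) * z i - t) ^ 2 ≤ (m * w) ^ 2 := by
      have : (m * w) ^ 2 = m * ((m + 1) * (1 - t ^ 2) - t ^ 2) := by rw [← hw]; ring
      rw [this]
      nlinarith
    have habs := abs_le_of_sq_le_sq' hsq (by positivity)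
    rw [le_div_iff₀ hm1, abs_eq_max_neg, max_mul_of_nonneg _ _ hm1.le, max_le_iff]
    constructor <;> linarith [habs.1, habs.2]

theorem sum_abs_le_of_pos {d : ℕ} (hd : 3 ≤ d) {f f' : ℝ → ℝ}
    (hf : ∀ y, 0 ≤ y → HasDerivAt f (f' y) y) (hconv : ConvexOn ℝ (Set.Ici 0) f') (h0 : f' 0 = 0)
    {x : Fin d → ℝ} (hx1 : ∑ i, x i = 0) (hx2 : ∑ i, x i ^ 2 = 1) {k : Fin d} (hk : 0 < x k)
    (hk2 : 1 ≤ 2 * x k ^ 2) :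
    ∃ a b : ℝ, 0 < a ∧ 0 ≤ b ∧ b ≤ a ∧
      (a + ((d : ℝ) - 2) * b) ^ 2 + a ^ 2 + ((d : ℝ) - 2) * b ^ 2 = 1 ∧
      ∑ i, f |x i| ≤ f (a + ((d : ℝ) - 2) * b) + f a + ((d : ℝ) - 2) * f b := by
  have hd' : (3 : ℝ) ≤ d := by exact_mod_cast hd
  have hcard : ((Finset.univ.erase k).card : ℝ) = ((d : ℝ) - 2) + 1 := by
    rw [Finset.card_erase_of_mem (Finset.mem_univ k), Finset.card_univ, Fintype.card_fin,
      Nat.cast_sub (by omega)]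
    push_cast; ring
  have e1 := Finset.add_sum_erase Finset.univ x (Finset.mem_univ k)
  have e2 := Finset.add_sum_erase Finset.univ (fun i => x i ^ 2) (Finset.mem_univ k)
  have e3 := Finset.add_sum_erase Finset.univ (fun i => f |x i|) (Finset.mem_univ k)
  simp only [hx2] at e2
  -- The negated remaining entries have the positive sum x k.
  have s1 : ∑ i ∈ Finset.univ.erase k, -x i = x k := by
    rw [Finset.sum_neg_distrib]; linarith
  have s2 : ∑ i ∈ Finset.univ.erase k, (-x i) ^ 2 = 1 - x k ^ 2 := by
    simp only [neg_sq]; linarith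
  obtain ⟨a, b, ha, hb, hba, h1, h2, hz⟩ := exists_two_level (by linarith) hcard hk
    (by linarith) s1 s2
  refine ⟨a, b, ha, hb, hba, by rw [h1]; linarith, ?_⟩
  have := sum_abs_le_of_moments hf hconv h0 hcard hb hba (s1.trans h1.symm) (s2.trans h2.symm) hz
  simp only [abs_neg] at this
  rw [h1, ← e3, abs_of_pos hk]
  linarith

/-- A zero-sum unit vector with an entry of square at least `1/2` is dominated by one of the form
`(a + (d - 2) b, -a, -b, …, -b)` with `0 ≤ b ≤ a`. -/
theorem sum_abs_le_two_level {d : ℕ} (hd : 3 ≤ d) {f f' : ℝ → ℝ}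
    (hf : ∀ y, 0 ≤ y → HasDerivAt f (f' y) y) (hconv : ConvexOn ℝ (Set.Ici 0) f') (h0 : f' 0 = 0)
    {x : Fin d → ℝ} (hx1 : ∑ i, x i = 0) (hx2 : ∑ i, x i ^ 2 = 1) {k : Fin d}
    (hk2 : 1 ≤ 2 * x k ^ 2) :
    ∃ a b : ℝ, 0 < a ∧ 0 ≤ b ∧ b ≤ a ∧
      (a + ((d : ℝ) - 2) * b) ^ 2 + a ^ 2 + ((d : ℝ) - 2) * b ^ 2 = 1 ∧
      ∑ i, f |x i| ≤ f (a + ((d : ℝ) - 2) * b) + f a + ((d : ℝ) - 2) * f b := by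
  rcases lt_trichotomy (x k) 0 with h | h | h
  · have := sum_abs_le_of_pos hd hf hconv h0 (x := fun i => -x i) (k := k) (by simpa using hx1)
      (by simpa using hx2) (by linarith) (by simpa using hk2)
    simpa using this
  · rw [h] at hk2; norm_num at hk2
  · exact sum_abs_le_of_pos hd hf hconv h0 hx1 hx2 h hk2

/-- `powerRatio` is scale invariant by its normalisation; dividing the vector by a leaves only the
ratio b/a. -/
theorem powerRatio_div {m q a b : ℝ} (hm : 0 ≤ m) (ha : 0 < a) (hb : 0 ≤ b)
    (h : (a + m * b) ^ 2 + a ^ 2 + m * b ^ 2 = 1) :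
    powerRatio m q (b / a) = (a + m * b) ^ (q + 1) + a ^ (q + 1) + m * b ^ (q + 1) := by
  have hT : 1 + m * (b / a) = (a + m * b) / a := by field_simp
  have hQ : (1 + m * (b / a)) ^ 2 + 1 + m * (b / a) ^ 2 = (a ^ 2)⁻¹ := by
    rw [hT]; field_simp; linarith
  have hp : ((a ^ 2)⁻¹) ^ (-(q + 1) / 2) = a ^ (q + 1) := by
    rw [Real.inv_rpow (by positivity), ← Real.rpow_neg (by positivity), ← Real.rpow_natCast,
      ← Real.rpow_mul ha.le]
    congr 1
    push_cast
    ring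
  rw [powerRatio, hQ, hp, hT, Real.div_rpow (by positivity) ha.le, Real.div_rpow hb ha.le]
  have : a ^ (q + 1) ≠ 0 := (Real.rpow_pos_of_pos ha _).ne'
  field_simp

theorem exists_sum_rpow_le_powerRatio {d : ℕ} (hd : 3 ≤ d) {q : ℝ} (hq : 1 ≤ q)
    {x : Fin d → ℝ} (hx1 : ∑ i, x i = 0) (hx2 : ∑ i, x i ^ 2 = 1) {k : Fin d}
    (hk2 : 1 ≤ 2 * x k ^ 2) :
    ∃ r ∈ Set.Icc (0 : ℝ) 1, ∑ i, |x i| ^ (q + 1) ≤ powerRatio ((d : ℝ) - 2) q r := by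
  have hd' : (3 : ℝ) ≤ d := by exact_mod_cast hd
  obtain ⟨a, b, ha, hb, hba, h, hle⟩ := sum_abs_le_two_level hd (f := fun y => y ^ (q + 1))
    (f' := fun y => (q + 1) * y ^ q)
    (fun y _ => by simpa using Real.hasDerivAt_rpow_const (x := y) (p := q + 1) (Or.inr (by linarith)))
    (by simpa using (convexOn_rpow hq).smul (show 0 ≤ q + 1 by linarith))
    (by simp [Real.zero_rpow (show q ≠ 0 by linarith)]) hx1 hx2 hk2
  exact ⟨b / a, ⟨by positivity, div_le_one_of_le₀ hba ha.le⟩,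
    hle.trans_eq (powerRatio_div (by linarith) ha hb h).symm⟩

/-- For 0 < q ≤ 1 the power y^q is concave, so the majorant is applied to -y^(q+1). -/
theorem exists_powerRatio_le_sum_rpow {d : ℕ} (hd : 3 ≤ d) {q : ℝ} (hq : 0 < q) (hq1 : q ≤ 1)
    {x : Fin d → ℝ} (hx1 : ∑ i, x i = 0) (hx2 : ∑ i, x i ^ 2 = 1) {k : Fin d}
    (hk2 : 1 ≤ 2 * x k ^ 2) :
    ∃ r ∈ Set.Icc (0 : ℝ) 1, powerRatio ((d : ℝ) - 2) q r ≤ ∑ i, |x i| ^ (q + 1) := by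
  have hd' : (3 : ℝ) ≤ d := by exact_mod_cast hd
  obtain ⟨a, b, ha, hb, hba, h, hle⟩ := sum_abs_le_two_level hd (f := fun y => -y ^ (q + 1))
    (f' := fun y => -((q + 1) * y ^ q))
    (fun y _ => by
      have := Real.hasDerivAt_rpow_const (x := y) (p := q + 1) (Or.inr (by linarith))
      rw [add_sub_cancel_right] at this
      exact this.neg)
    ((Real.concaveOn_rpow hq.le hq1).smul (show 0 ≤ q + 1 by linarith)).neg
    (by simp [Real.zero_rpow hq.ne']) hx1 hx2 hk2
  refine ⟨b / a, ⟨by positivity, div_le_one_of_le₀ hba ha.le⟩, ?_⟩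
  rw [powerRatio_div (by linarith) ha hb h]
  rw [Finset.sum_neg_distrib] at hle
  linarith

/-! ### Values at the two ends -/

theorem powerRatio_zero {m α : ℝ} (hα : 0 < α) : powerRatio m (2 * α - 1) 0 = 2 ^ (1 - α) := by
  have : (2 : ℝ) ^ (1 - α) = 2 * 2 ^ (-α) := by
    rw [sub_eq_add_neg, Real.rpow_add two_pos, Real.rpow_one]
  rw [this, powerRatio]
  have h1 : 2 * α - 1 + 1 = 2 * α := by ring
  have h2 : -(2 * α) / 2 = -α := by ring
  rw [h1, h2, Real.zero_rpow (by linarith)]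
  norm_num

theorem powerRatio_one {d : ℝ} (hd : 1 < d) (α : ℝ) : powerRatio (d - 2) (2 * α - 1) 1 =
    ((d - 1) ^ α + (d - 1) ^ (1 - α)) / d ^ α := by
  have h0 : 0 < d - 1 := by linarith
  have hd0 : 0 < d := by linarith
  have h1 : 2 * α - 1 + 1 = α + α := by ring
  have h2 : -(α + α) / 2 = -α := by ring
  have h3 : 1 + (d - 2) * 1 = d - 1 := by ring
  have h4 : (d - 1) ^ 2 + 1 + (d - 2) * 1 ^ 2 = (d - 1) * d := by ring
  rw [powerRatio, h1, h2, h3, h4, Real.mul_rpow h0.le hd0.le, Real.one_rpow,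
    Real.rpow_add h0, Real.rpow_neg h0.le, Real.rpow_neg hd0.le, Real.rpow_sub h0, Real.rpow_one]
  have : (d - 1) ^ α ≠ 0 := (Real.rpow_pos_of_pos h0 _).ne'
  have : d ^ α ≠ 0 := (Real.rpow_pos_of_pos hd0 _).ne'
  field_simp
  ring

/-! ### Bounds for the power sums -/

theorem sum_eq_zero_of_mem {d : ℕ} {x : EuclideanSpace ℝ (Fin d)} (hx : x ∈ zeroSumSphere d) :
    ∑ i, x i = 0 := hx.2

theorem sum_sq_eq_one_of_mem {d : ℕ} {x : EuclideanSpace ℝ (Fin d)} (hx : x ∈ zeroSumSphere d) :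
    ∑ i, x i ^ 2 = 1 := by
  have := EuclideanSpace.real_norm_sq_eq x
  rw [hx.1] at this
  linarith

theorem sq_rpow_of_nonneg {y : ℝ} (hy : 0 ≤ y) (α : ℝ) : (y ^ 2) ^ α = y ^ (2 * α) := by
  rw [Real.rpow_mul hy, Real.rpow_two]

theorem two_mul_half_rpow (α : ℝ) : 2 * (1 / 2 : ℝ) ^ α = 2 ^ (1 - α) := by
  rw [Real.rpow_sub two_pos, Real.rpow_one, one_div, Real.inv_rpow two_pos.le]
  rfl

theorem half_rpow_sub_one (α : ℝ) : (1 / 2 : ℝ) ^ (α - 1) = 2 ^ (1 - α) := by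
  rw [one_div, Real.inv_rpow two_pos.le, ← Real.rpow_neg two_pos.le]
  ring_nf

theorem sum_rpow_le_of_le_half {d : ℕ} {p : Fin d → ℝ} (hp : ∀ i, 0 ≤ p i) (hs : ∑ i, p i = 1)
    (hh : ∀ i, 2 * p i ≤ 1) {α : ℝ} (hα : 1 < α) : ∑ i, p i ^ α ≤ 2 ^ (1 - α) := by
  calc ∑ i, p i ^ α ≤ ∑ i, p i * 2 ^ (1 - α) := by
        refine Finset.sum_le_sum fun i _ => ?_
        rcases (hp i).eq_or_lt with h | h
        · rw [← h, Real.zero_rpow (by linarith), zero_mul]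
        · rw [← half_rpow_sub_one, ← sub_add_cancel α 1, Real.rpow_add_one h.ne', mul_comm,
            add_sub_cancel_right]
          gcongr
          linarith [hh i]
    _ = 2 ^ (1 - α) := by rw [← Finset.sum_mul, hs, one_mul]

theorem le_sum_rpow_of_le_half {d : ℕ} {p : Fin d → ℝ} (hp : ∀ i, 0 ≤ p i) (hs : ∑ i, p i = 1)
    (hh : ∀ i, 2 * p i ≤ 1) {α : ℝ} (hα0 : 0 < α) (hα : α < 1) :
    2 ^ (1 - α) ≤ ∑ i, p i ^ α := by
  calc (2 : ℝ) ^ (1 - α) = ∑ i, p i * 2 ^ (1 - α) := by rw [← Finset.sum_mul, hs, one_mul]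
    _ ≤ ∑ i, p i ^ α := by
        refine Finset.sum_le_sum fun i _ => ?_
        rcases (hp i).eq_or_lt with h | h
        · rw [← h, Real.zero_rpow hα0.ne', zero_mul]
        · rw [← half_rpow_sub_one, ← sub_add_cancel α 1, Real.rpow_add_one h.ne', mul_comm,
            add_sub_cancel_right]
          refine mul_le_mul_of_nonneg_right ?_ h.le
          exact Real.rpow_le_rpow_of_nonpos h (by linarith [hh i]) (by linarith)

/-- The entry x k has the largest absolute value and, the sum being zero, 2|x k| ≤ ∑|x i|. As 2α - 1
≤ 0, each |x i|^(2α) is at least |x i|·|x k|^(2α-1). -/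
theorem le_sum_rpow_of_exponent_le_half {d : ℕ} {x : Fin d → ℝ} (hx1 : ∑ i, x i = 0)
    (hx2 : ∑ i, x i ^ 2 = 1) {k : Fin d} (hk : 1 ≤ 2 * x k ^ 2) {α : ℝ} (hα0 : 0 < α)
    (hα : 2 * α ≤ 1) : 2 ^ (1 - α) ≤ ∑ i, |x i| ^ (2 * α) := by
  have e2 := Finset.add_sum_erase Finset.univ (fun i => x i ^ 2) (Finset.mem_univ k)
  have hk0 : 0 < |x k| := abs_pos.2 fun h => by norm_num [h] at hk
  have hle : ∀ i, |x i| ≤ |x k| := by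
    intro i
    rcases eq_or_ne i k with rfl | hik
    · exact le_rfl
    have := Finset.single_le_sum (f := fun i => x i ^ 2) (fun j _ => sq_nonneg (x j))
      (Finset.mem_erase.2 ⟨hik, Finset.mem_univ i⟩)
    refine sq_le_sq.1 ?_
    linarith
  have hsum : 2 * |x k| ≤ ∑ i, |x i| := by
    have e1 := Finset.add_sum_erase Finset.univ x (Finset.mem_univ k)
    have e3 := Finset.add_sum_erase Finset.univ (fun i => |x i|) (Finset.mem_univ k)
    have e4 := Finset.abs_sum_le_sum_abs x (Finset.univ.erase k)
    rw [show ∑ i ∈ Finset.univ.erase k, x i = -x k by linarith, abs_neg] at e4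
    linarith
  calc (2 : ℝ) ^ (1 - α) = 2 * (1 / 2) ^ α := (two_mul_half_rpow α).symm
    _ ≤ 2 * (|x k| ^ 2) ^ α := by
        gcongr
        rw [sq_abs]; linarith
    _ = 2 * |x k| * |x k| ^ (2 * α - 1) := by
        rw [sq_rpow_of_nonneg hk0.le, mul_assoc, mul_comm |x k|, ← Real.rpow_add_one hk0.ne']
        ring_nf
    _ ≤ (∑ i, |x i|) * |x k| ^ (2 * α - 1) := by gcongr
    _ ≤ ∑ i, |x i| ^ (2 * α) := by
        rw [Finset.sum_mul]
        refine Finset.sum_le_sum fun i _ => ?_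
        rcases (abs_nonneg (x i)).eq_or_lt with h | h
        · rw [← h, zero_mul]; positivity
        · have : |x i| ^ (2 * α) = |x i| * |x i| ^ (2 * α - 1) := by
            rw [mul_comm |x i|, ← Real.rpow_add_one h.ne']; ring_nf
          rw [this]
          exact mul_le_mul_of_nonneg_left
            (Real.rpow_le_rpow_of_nonpos h (hle i) (by linarith)) h.le

theorem sum_sqDensity {d : ℕ} {x : EuclideanSpace ℝ (Fin d)} (hx : x ∈ zeroSumSphere d) :
    ∑ i, sqDensity x i = 1 := by
  simpa [sqDensity] using sum_sq_eq_one_of_mem hx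

theorem sqDensity_nonneg {d : ℕ} (x : EuclideanSpace ℝ (Fin d)) (i : Fin d) :
    0 ≤ sqDensity x i := by
  unfold sqDensity; positivity

theorem sum_sqDensity_rpow_le {d : ℕ} (hd : 3 ≤ d) {x : EuclideanSpace ℝ (Fin d)}
    (hx : x ∈ zeroSumSphere d) {α : ℝ} (hα : 1 < α) :
    ∑ i, sqDensity x i ^ α ≤ max (2 ^ (1 - α))
      ((((d : ℝ) - 1) ^ α + ((d : ℝ) - 1) ^ (1 - α)) / (d : ℝ) ^ α) := by
  have hd' : (3 : ℝ) ≤ d := by exact_mod_cast hd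
  by_cases h : ∀ i, 2 * sqDensity x i ≤ 1
  · exact le_max_of_le_left
      (sum_rpow_le_of_le_half (sqDensity_nonneg x) (sum_sqDensity hx) h hα)
  push Not at h
  obtain ⟨k, hk⟩ := h
  simp only [sqDensity, sq_abs] at hk
  obtain ⟨r, hr, hle⟩ := exists_sum_rpow_le_powerRatio hd (q := 2 * α - 1) (by linarith)
    (sum_eq_zero_of_mem hx) (sum_sq_eq_one_of_mem hx) hk.le
  have hm : (d : ℝ) - 2 = 1 ∨ 2 ≤ (d : ℝ) - 2 := by
    rcases hd.eq_or_lt with h | h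
    · left; rw [← h]; norm_num
    · right
      have : (4 : ℝ) ≤ d := by exact_mod_cast h
      linarith
  have := hle.trans (powerRatio_le_max hm (by linarith) hr)
  rw [powerRatio_zero (by linarith), powerRatio_one (by linarith), sub_add_cancel] at this
  simpa only [sqDensity, sq_rpow_of_nonneg (abs_nonneg _)] using this

theorem le_sum_sqDensity_rpow {d : ℕ} (hd : 3 ≤ d) {x : EuclideanSpace ℝ (Fin d)}
    (hx : x ∈ zeroSumSphere d) {α : ℝ} (hα0 : 0 < α) (hα : α < 1) :
    min (2 ^ (1 - α)) ((((d : ℝ) - 1) ^ α + ((d : ℝ) - 1) ^ (1 - α)) / (d : ℝ) ^ α) ≤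
      ∑ i, sqDensity x i ^ α := by
  have hd' : (3 : ℝ) ≤ d := by exact_mod_cast hd
  by_cases h : ∀ i, 2 * sqDensity x i ≤ 1
  · exact min_le_of_left_le
      (le_sum_rpow_of_le_half (sqDensity_nonneg x) (sum_sqDensity hx) h hα0 hα)
  push Not at h
  obtain ⟨k, hk⟩ := h
  simp only [sqDensity, sq_abs] at hk
  simp only [sqDensity, sq_rpow_of_nonneg (abs_nonneg _)]
  rcases le_or_gt (2 * α) 1 with h1 | h1
  · exact min_le_of_left_le (le_sum_rpow_of_exponent_le_half (sum_eq_zero_of_mem hx)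
      (sum_sq_eq_one_of_mem hx) hk.le hα0 h1)
  obtain ⟨r, hr, hle⟩ := exists_powerRatio_le_sum_rpow hd (q := 2 * α - 1) (by linarith)
    (by linarith) (sum_eq_zero_of_mem hx) (sum_sq_eq_one_of_mem hx) hk.le
  have := (min_le_powerRatio (by linarith) (by linarith) (by linarith) hr).trans hle
  rwa [powerRatio_zero (by linarith), powerRatio_one (by linarith), sub_add_cancel] at this

/-! ### The two extremal vectors -/

theorem exists_two_level_mem {d : ℕ} (hd : 3 ≤ d) {a b : ℝ}
    (h : (a + ((d : ℝ) - 2) * b) ^ 2 + a ^ 2 + ((d : ℝ) - 2) * b ^ 2 = 1) :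
    ∃ x ∈ zeroSumSphere d, ∀ g : ℝ → ℝ, ∑ i, g (sqDensity x i) =
      g ((a + ((d : ℝ) - 2) * b) ^ 2) + g (a ^ 2) + ((d : ℝ) - 2) * g (b ^ 2) := by
  obtain ⟨k, rfl⟩ := Nat.exists_eq_add_of_le' hd
  set t := a + (((k + 3 : ℕ) : ℝ) - 2) * b with ht
  have hk : ((k + 3 : ℕ) : ℝ) - 2 = (k : ℝ) + 1 := by push_cast; ring
  let x : EuclideanSpace ℝ (Fin (k + 3)) :=
    WithLp.toLp 2 (Fin.cons t (Fin.cons (-a) fun _ => -b))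
  have hsum : ∀ g : ℝ → ℝ, ∑ i, g (x i) = g t + g (-a) + ((k : ℝ) + 1) * g (-b) := by
    intro g
    simp only [x]
    rw [Fin.sum_univ_succ, Fin.sum_univ_succ]
    simp
    ring
  refine ⟨x, ⟨?_, ?_⟩, fun g => ?_⟩
  · have := hsum (fun y => y ^ 2)
    rw [← EuclideanSpace.real_norm_sq_eq x] at this
    rw [hk] at h
    have h1 : ‖x‖ ^ 2 = 1 := by rw [this]; simpa using h
    exact (pow_eq_one_iff_of_nonneg (norm_nonneg x) two_ne_zero).1 h1
  · rw [hsum (fun y => y), ht, hk]; ring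
  · have := hsum (fun y => g (|y| ^ 2))
    simp only [sq_abs, neg_sq] at this
    rw [hk, ← this]
    simp only [sqDensity, sq_abs]

theorem exists_mem_entropy_eq_log_two {d : ℕ} (hd : 3 ≤ d) :
    ∃ x ∈ zeroSumSphere d, (∀ α : ℝ, 0 < α → α ≠ 1 →
      renyiEntropy α (sqDensity x) = Real.log 2) ∧
      shannonEntropy (sqDensity x) = Real.log 2 := by
  have hc : (Real.sqrt (1 / 2)) ^ 2 = 1 / 2 := Real.sq_sqrt (by norm_num)
  obtain ⟨x, hx, hsum⟩ := exists_two_level_mem hd (a := Real.sqrt (1 / 2)) (b := 0)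
    (by simp only [mul_zero, add_zero, hc]; norm_num)
  simp only [mul_zero, add_zero, hc] at hsum
  refine ⟨x, hx, fun α h0 h1 => ?_, ?_⟩
  · have := hsum (fun y => y ^ α)
    have h1' : 1 - α ≠ 0 := sub_ne_zero.2 h1.symm
    rw [renyiEntropy, this, zero_pow two_ne_zero, Real.zero_rpow h0.ne', mul_zero, add_zero,
      ← two_mul, two_mul_half_rpow, Real.log_rpow two_pos]
    field_simp
  · have := hsum (fun y => y * Real.log y)
    rw [shannonEntropy, this, one_div, Real.log_inv]
    ring_nf

theorem exists_mem_entropy_eq_simplex {d : ℕ} (hd : 3 ≤ d) :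
    ∃ x ∈ zeroSumSphere d, (∀ α : ℝ, renyiEntropy α (sqDensity x) = 1 / (1 - α) *
      Real.log ((((d : ℝ) - 1) ^ α + ((d : ℝ) - 1) ^ (1 - α)) / (d : ℝ) ^ α)) ∧
      shannonEntropy (sqDensity x) =
        Real.log d - ((d : ℝ) - 2) / d * Real.log ((d : ℝ) - 1) := by
  have hd' : (3 : ℝ) ≤ d := by exact_mod_cast hd
  have h0 : 0 < (d : ℝ) - 1 := by linarith
  have h1 : 0 < (d : ℝ) := by linarith
  -- This c normalises (d-1, -1, …, -1): both levels equal c.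
  obtain ⟨c, hc0, hc⟩ : ∃ c : ℝ, 0 < c ∧ c ^ 2 = (((d : ℝ) - 1) * d)⁻¹ :=
    ⟨_, Real.sqrt_pos.2 (by positivity), Real.sq_sqrt (by positivity)⟩
  have hT : (c + ((d : ℝ) - 2) * c) ^ 2 = ((d : ℝ) - 1) / d := by
    rw [show c + ((d : ℝ) - 2) * c = ((d : ℝ) - 1) * c by ring, mul_pow, hc]
    field_simp
  have hnorm : (c + ((d : ℝ) - 2) * c) ^ 2 + c ^ 2 + ((d : ℝ) - 2) * c ^ 2 = 1 := by
    rw [hT, hc]; field_simp; ring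
  obtain ⟨x, hx, hsum⟩ := exists_two_level_mem hd hnorm
  refine ⟨x, hx, fun α => ?_, ?_⟩
  · have := hsum (fun y => y ^ α)
    have h2 : 0 ≤ (d : ℝ) - 2 := by linarith
    have e := powerRatio_div (q := 2 * α - 1) h2 hc0 hc0.le hnorm
    simp only [sq_rpow_of_nonneg hc0.le,
      sq_rpow_of_nonneg (show 0 ≤ c + ((d : ℝ) - 2) * c by positivity)] at this
    rw [sub_add_cancel, ← this, div_self hc0.ne', powerRatio_one (by linarith)] at e
    rw [renyiEntropy, ← e]
  · have := hsum (fun y => y * Real.log y)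
    rw [shannonEntropy, this, hT, hc, Real.log_inv, Real.log_mul h0.ne' h1.ne',
      Real.log_div h0.ne' h1.ne']
    field_simp
    ring

/-! ### Shannon entropy as a limit, and the Rényi lower bound -/

/-- As ∑ p_i = 1, the Rényi entropy is minus the difference quotient of α ↦ log ∑ p_i^α at α = 1. -/
theorem tendsto_renyiEntropy {d : ℕ} {p : Fin d → ℝ} (hp : ∀ i, 0 ≤ p i) (hs : ∑ i, p i = 1) :
    Tendsto (fun α : ℝ => renyiEntropy α p) (𝓝[≠] 1) (𝓝 (shannonEntropy p)) := by
  have hd : ∀ i, HasDerivAt (fun α : ℝ => p i ^ α) (p i * Real.log (p i)) 1 := by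
    intro i
    rcases (hp i).eq_or_lt with h | h
    · rw [← h, zero_mul]
      refine (hasDerivAt_const (1 : ℝ) (0 : ℝ)).congr_of_eventuallyEq ?_
      filter_upwards [lt_mem_nhds (zero_lt_one' ℝ)] with α hα
      exact Real.zero_rpow hα.ne'
    · simpa using (Real.hasStrictDerivAt_const_rpow h 1).hasDerivAt
  have hsum : HasDerivAt (fun α : ℝ => ∑ i, p i ^ α) (∑ i, p i * Real.log (p i)) 1 :=
    HasDerivAt.fun_sum fun i _ => hd i
  have h1 : ∑ i, p i ^ (1 : ℝ) = 1 := by simpa using hs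
  have hlog := hsum.log (by rw [h1]; exact one_ne_zero)
  rw [h1, div_one] at hlog
  have := hlog.tendsto_slope.neg
  refine this.congr fun α => ?_
  rw [slope_def_field, h1, Real.log_one, sub_zero, renyiEntropy, ← neg_sub α 1, div_neg]
  ring

theorem min_le_renyiEntropy {d : ℕ} (hd : 3 ≤ d) {x : EuclideanSpace ℝ (Fin d)}
    (hx : x ∈ zeroSumSphere d) {α : ℝ} (hα0 : 0 < α) (hα : α ≠ 1) :
    min (Real.log 2) (1 / (1 - α) *
      Real.log ((((d : ℝ) - 1) ^ α + ((d : ℝ) - 1) ^ (1 - α)) / (d : ℝ) ^ α)) ≤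
      renyiEntropy α (sqDensity x) := by
  have hd' : (3 : ℝ) ≤ d := by exact_mod_cast hd
  have h0 : 0 < (d : ℝ) - 1 := by linarith
  have hE : 0 < (((d : ℝ) - 1) ^ α + ((d : ℝ) - 1) ^ (1 - α)) / (d : ℝ) ^ α := by positivity
  have hlog2 : Real.log 2 = 1 / (1 - α) * Real.log (2 ^ (1 - α)) := by
    have : 1 - α ≠ 0 := sub_ne_zero.2 hα.symm
    rw [Real.log_rpow two_pos]; field_simp
  have h2 : (0 : ℝ) < 2 ^ (1 - α) := by positivity
  rw [renyiEntropy, hlog2]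
  rcases lt_or_gt_of_ne hα with h | h
  · have hc : 0 ≤ 1 / (1 - α) := one_div_nonneg.2 (by linarith)
    rcases min_le_iff.1 (le_sum_sqDensity_rpow hd hx hα0 h) with hle | hle
    · exact min_le_of_left_le (mul_le_mul_of_nonneg_left (Real.log_le_log h2 hle) hc)
    · exact min_le_of_right_le (mul_le_mul_of_nonneg_left (Real.log_le_log hE hle) hc)
  · have hc : 1 / (1 - α) ≤ 0 := one_div_nonpos.2 (by linarith)
    have hpos : 0 < ∑ i, sqDensity x i ^ α := by
      obtain ⟨i, hi⟩ : ∃ i, 0 < sqDensity x i := by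
        by_contra! hneg
        have := Finset.sum_nonpos fun i (_ : i ∈ Finset.univ) => hneg i
        rw [sum_sqDensity hx] at this
        linarith
      exact Finset.sum_pos' (fun j _ => Real.rpow_nonneg (sqDensity_nonneg x j) α)
        ⟨i, Finset.mem_univ i, Real.rpow_pos_of_pos hi α⟩
    rcases le_max_iff.1 (sum_sqDensity_rpow_le hd hx h) with hle | hle
    · exact min_le_of_left_le (mul_le_mul_of_nonpos_left (Real.log_le_log hpos hle) hc)
    · exact min_le_of_right_le (mul_le_mul_of_nonpos_left (Real.log_le_log hpos hle) hc)

/-! ### Comparison of the two Shannon values -/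

theorem log_two_le_of_pow_le {d : ℕ} (hd : 3 ≤ d) (h : (d - 1) ^ (d - 2) * 2 ^ d ≤ d ^ d) :
    Real.log 2 ≤ Real.log d - ((d : ℝ) - 2) / d * Real.log ((d : ℝ) - 1) := by
  have hd' : (3 : ℝ) ≤ d := by exact_mod_cast hd
  have h0 : 0 < (d : ℝ) - 1 := by linarith
  have h1 : ((d : ℝ) - 1) ^ (d - 2) * 2 ^ d ≤ (d : ℝ) ^ d := by
    have : (((d - 1 : ℕ) : ℝ)) ^ (d - 2) * 2 ^ d ≤ (d : ℝ) ^ d := by exact_mod_cast h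
    rwa [Nat.cast_sub (by omega), Nat.cast_one] at this
  have h2 := Real.log_le_log (by positivity) h1
  rw [Real.log_mul (by positivity) (by positivity), Real.log_pow, Real.log_pow, Real.log_pow,
    Nat.cast_sub (by omega), Nat.cast_ofNat] at h2
  rw [div_mul_eq_mul_div, le_sub_iff_add_le, ← le_sub_iff_add_le', div_le_iff₀ (by linarith)]
  linarith

theorem le_log_two_of_seven_le {d : ℝ} (hd : 7 ≤ d) :
    Real.log d - (d - 2) / d * Real.log (d - 1) ≤ Real.log 2 := by
  have h0 : 0 < d - 1 := by linarith
  have h1 : 0 < d := by linarith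
  have hquot : Real.log d - Real.log (d - 1) ≤ 1 / (d - 1) := by
    rw [← Real.log_div h1.ne' h0.ne']
    refine (Real.log_le_sub_one_of_pos (by positivity)).trans_eq ?_
    field_simp; ring
  have hquot' : d * (Real.log d - Real.log (d - 1)) ≤ 7 / 6 := by
    refine (mul_le_mul_of_nonneg_left hquot h1.le).trans ?_
    rw [mul_one_div, div_le_div_iff₀ h0 (by norm_num)]
    linarith
  -- The tangent to log at 6 reduces everything to a linear inequality in d, whose margin at d = 7
  -- is small; 3⁵ ≤ 2⁸ bounds log 3 closely enough.
  have htan : Real.log (d - 1) ≤ Real.log 6 + ((d - 1) / 6 - 1) := by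
    have := Real.log_le_sub_one_of_pos (show 0 < (d - 1) / 6 by positivity)
    rw [Real.log_div h0.ne' (by norm_num)] at this
    linarith
  have h6 : Real.log 6 = Real.log 2 + Real.log 3 := by
    rw [← Real.log_mul (by norm_num) (by norm_num)]; norm_num
  have h3 : 5 * Real.log 3 ≤ 8 * Real.log 2 := by
    have := Real.log_le_log (by norm_num) (show (3 : ℝ) ^ 5 ≤ 2 ^ 8 by norm_num)
    rw [Real.log_pow, Real.log_pow] at this
    exact_mod_cast this
  have hl2 := Real.log_two_gt_d9
  rw [div_mul_eq_mul_div, sub_le_iff_le_add, ← sub_le_iff_le_add', le_div_iff₀ h1]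
  nlinarith

theorem min_log_two_eq_ite {d : ℕ} (hd : 3 ≤ d) :
    min (Real.log 2) (Real.log d - ((d : ℝ) - 2) / d * Real.log ((d : ℝ) - 1)) =
      if d ≤ 6 then Real.log 2
        else Real.log d - ((d : ℝ) - 2) / d * Real.log ((d : ℝ) - 1) := by
  split_ifs with h
  · refine min_eq_left (log_two_le_of_pow_le hd ?_)
    interval_cases d <;> norm_num
  · exact min_eq_right (le_log_two_of_seven_le (by exact_mod_cast not_le.1 h))

/-! ### The main theorem -/

theorem corollary1p3 (d : ℕ) (hd : 3 ≤ d) :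
    (∀ α : ℝ, 0 < α → α ≠ 1 →
      IsLeast ((fun x => renyiEntropy α (sqDensity x)) '' zeroSumSphere d)
        (min (Real.log 2)
          (1 / (1 - α) *
            Real.log ((((d : ℝ) - 1) ^ α + ((d : ℝ) - 1) ^ (1 - α)) / (d : ℝ) ^ α)))) ∧
    IsLeast ((fun x => shannonEntropy (sqDensity x)) '' zeroSumSphere d)
      (if d ≤ 6 then Real.log 2
        else Real.log d - ((d : ℝ) - 2) / d * Real.log ((d : ℝ) - 1)) ∧
    Tendsto (fun α : ℝ => sInf ((fun x => renyiEntropy α (sqDensity x)) '' zeroSumSphere d))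
      (𝓝[≠] 1) (𝓝 (sInf ((fun x => shannonEntropy (sqDensity x)) '' zeroSumSphere d))) := by
  obtain ⟨u, hu, hur, hus⟩ := exists_mem_entropy_eq_log_two hd
  obtain ⟨v, hv, hvr, hvs⟩ := exists_mem_entropy_eq_simplex hd
  have hR : ∀ α : ℝ, 0 < α → α ≠ 1 →
      IsLeast ((fun x => renyiEntropy α (sqDensity x)) '' zeroSumSphere d)
        (min (Real.log 2) (1 / (1 - α) *
          Real.log ((((d : ℝ) - 1) ^ α + ((d : ℝ) - 1) ^ (1 - α)) / (d : ℝ) ^ α))) := by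
    intro α h0 h1
    refine ⟨?_, ?_⟩
    · rcases min_choice (Real.log 2) (1 / (1 - α) *
          Real.log ((((d : ℝ) - 1) ^ α + ((d : ℝ) - 1) ^ (1 - α)) / (d : ℝ) ^ α)) with h | h
      · rw [h]; exact ⟨u, hu, hur α h0 h1⟩
      · rw [h]; exact ⟨v, hv, hvr α⟩
    · rintro _ ⟨x, hx, rfl⟩
      exact min_le_renyiEntropy hd hx h0 h1
  have hpos : ∀ᶠ α : ℝ in 𝓝[≠] 1, 0 < α ∧ α ≠ 1 :=
    (eventually_nhdsWithin_of_eventually_nhds (lt_mem_nhds zero_lt_one)).and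
      eventually_mem_nhdsWithin
  have hlim : Tendsto (fun α : ℝ => min (Real.log 2) (1 / (1 - α) *
      Real.log ((((d : ℝ) - 1) ^ α + ((d : ℝ) - 1) ^ (1 - α)) / (d : ℝ) ^ α))) (𝓝[≠] 1)
      (𝓝 (min (Real.log 2) (Real.log d - ((d : ℝ) - 2) / d * Real.log ((d : ℝ) - 1)))) := by
    -- The closed form is the Rényi entropy of v, so its limit is the Shannon entropy of v.
    have := tendsto_renyiEntropy (sqDensity_nonneg v) (sum_sqDensity hv)
    simp only [hvr, hvs] at this
    exact tendsto_const_nhds.min this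
  have hS : IsLeast ((fun x => shannonEntropy (sqDensity x)) '' zeroSumSphere d)
      (min (Real.log 2) (Real.log d - ((d : ℝ) - 2) / d * Real.log ((d : ℝ) - 1))) := by
    refine ⟨?_, ?_⟩
    · rcases min_choice (Real.log 2)
          (Real.log d - ((d : ℝ) - 2) / d * Real.log ((d : ℝ) - 1)) with h | h
      · rw [h]; exact ⟨u, hu, hus⟩
      · rw [h]; exact ⟨v, hv, hvs⟩
    · rintro _ ⟨x, hx, rfl⟩
      refine le_of_tendsto_of_tendsto hlim
        (tendsto_renyiEntropy (sqDensity_nonneg x) (sum_sqDensity hx)) ?_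
      filter_upwards [hpos] with α hα
      exact min_le_renyiEntropy hd hx hα.1 hα.2
  refine ⟨hR, min_log_two_eq_ite hd ▸ hS, ?_⟩
  rw [hS.csInf_eq]
  refine hlim.congr' ?_
  filter_upwards [hpos] with α hα
  exact (hR α hα.1 hα.2).csInf_eq.symm
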